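/- Let $n \ge 0$ be an integer. A cover on $\mathbb{R}^n$ consists of a family $\mathcal{H}$ of subsets of $\mathbb{R}^n$ together with a nonzero ordinal $m(H)$ (the multiplicity) for each $H \in \mathcal{H}$; its members are the pairs $\langle H,\alpha\rangle$ with $H\in\mathcal{H}$ and $\alpha<m(H)$, and a member $\langle H,\alpha\rangle$ contains the points of $H$. For a cardinal $\kappa$, it is a $\kappa$-fold cover of $\mathbb{R}^n$ if every $x\in\mathbb{R}^n$ is contained in at least $\kappa$ members. A subcover is a set of members such that every $x\in\mathbb{R}^n$ is contained in one of them. Corollary 7.4. Let $\kappa$ be an uncountable cardinal. Consider a $\kappa$-fold cover of $\mathbb{R}^n$, with underlying family $\mathcal{H}$, that satisfies one of the following. 1. Every $H\in\mathcal{H}$ is of the form $\bigcup_{i<\omega}(V_i\cap G_i)$, where each $G_i\subseteq\mathbb{R}^n$ is open and each $V_i$ is a real affine variety, that is, the set of common zeros in $\mathbb{R}^n$ of some set of polynomials in $\mathbb{R}[x_1,\dots,x_n]$. 2. Every $H\in\mathcal{H}$ is an open or closed polyhedron. Here a polyhedron is a finite union of intersections of finitely many (open or closed) half-spaces, not necessarily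 convex, bounded or of full dimension, and an open (closed) polyhedron is one that is open (closed) as a subset of $\mathbb{R}^n$. 3. Every $H\in\mathcal{H}$ is an open Euclidean ball of positive radius or a closed Euclidean ball of radius $\ge 0$. Then the set of members of the cover can be partitioned into exactly $\kappa$ many pairwise disjoint subcovers of $\mathbb{R}^n$. -/

import Mathlib

universe u

/-- A cover on `X` in which sets may be used several times: a family `sets` of subsets of `X`
together with a multiplicity, a nonzero ordinal, for each set of the family. -/
structure MultiCover (X : Type) where
  sets : Set (Set X)
  mult : sets → Ordinal.{u}
  mult_ne_zero : ∀ H, mult H ≠ 0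

namespace MultiCover

variable {X : Type}

/-- The members of the cover: the pairs `⟨H, α⟩` with `H` in the family and `α < mult H`. -/
def Member (C : MultiCover.{u} X) : Type u :=
  Σ H : C.sets, (C.mult H).ToType

/-- The subset of `X` that underlies a member of the cover. -/
def Member.toSet {C : MultiCover.{u} X} (p : C.Member) : Set X := (p.1 : Set X)

/-- The members that contain the point `x`. -/
def membersAt (C : MultiCover.{u} X) (x : X) : Set C.Member := {p | x ∈ p.toSet}

/-- Every point of `X` lies in at least `κ` members, counted with multiplicity. -/
def IsFoldCover (C : MultiCover.{u} X) (κ : Cardinal.{u}) : Prop :=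
  ∀ x : X, κ ≤ Cardinal.mk (C.membersAt x)

/-- A collection of members that still covers `X`. -/
def IsSubcover (C : MultiCover.{u} X) (S : Set C.Member) : Prop :=
  ∀ x : X, ∃ p ∈ S, x ∈ p.toSet

/-- The members can be partitioned into exactly `κ` many collections, each of which covers `X`. -/
def SplitsInto (C : MultiCover.{u} X) (κ : Cardinal.{u}) : Prop :=
  ∃ P : Set (Set C.Member),
    Setoid.IsPartition P ∧ Cardinal.mk P = κ ∧ ∀ S ∈ P, C.IsSubcover S

end MultiCover

/-- A real affine variety in `ℝⁿ`: the common zero set of an ideal (equivalently, of a set) of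
real polynomials in `n` variables. It need not be irreducible. -/
def IsRealAffineVariety {n : ℕ} (V : Set (EuclideanSpace ℝ (Fin n))) : Prop :=
  ∃ I : Ideal (MvPolynomial (Fin n) ℝ),
    V = {x | (fun i => x i) ∈ MvPolynomial.zeroLocus ℝ I}

/-- A countable union of relatively open subsets of real affine varieties. (The empty set is a
variety, so finite unions are included.) -/
def IsCountableUnionOfRelOpen {n : ℕ} (H : Set (EuclideanSpace ℝ (Fin n))) : Prop :=
  ∃ V G : ℕ → Set (EuclideanSpace ℝ (Fin n)),
    (∀ i, IsRealAffineVariety (V i)) ∧ (∀ i, IsOpen (G i)) ∧ H = ⋃ i, V i ∩ G i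

/-- A closed or open half-space of `ℝⁿ`. -/
def IsHalfSpace {n : ℕ} (F : Set (EuclideanSpace ℝ (Fin n))) : Prop :=
  ∃ (a : EuclideanSpace ℝ (Fin n)) (b : ℝ), a ≠ 0 ∧
    (F = {x | inner ℝ a x ≤ b} ∨ F = {x | inner ℝ a x < b})

/-- A convex polyhedron: the intersection of finitely many half-spaces, possibly unbounded or
of lower dimension. -/
def IsConvexPolyhedron {n : ℕ} (P : Set (EuclideanSpace ℝ (Fin n))) : Prop :=
  ∃ Fs : Set (Set (EuclideanSpace ℝ (Fin n))),
    Fs.Finite ∧ (∀ F ∈ Fs, IsHalfSpace F) ∧ P = ⋂₀ Fs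

/-- A polyhedron, not necessarily convex: a finite union of convex polyhedra. -/
def IsPolyhedron {n : ℕ} (P : Set (EuclideanSpace ℝ (Fin n))) : Prop :=
  ∃ Cs : Set (Set (EuclideanSpace ℝ (Fin n))),
    Cs.Finite ∧ (∀ C ∈ Cs, IsConvexPolyhedron C) ∧ P = ⋃₀ Cs

/-- A polyhedron that is an open set or a closed set. -/
def IsOpenOrClosedPolyhedron {n : ℕ} (P : Set (EuclideanSpace ℝ (Fin n))) : Prop :=
  IsPolyhedron P ∧ (IsOpen P ∨ IsClosed P)

/-- An open ball of positive radius or a closed ball of nonnegative radius. -/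
def IsOpenOrClosedBall {n : ℕ} (B : Set (EuclideanSpace ℝ (Fin n))) : Prop :=
  ∃ (c : EuclideanSpace ℝ (Fin n)) (r : ℝ),
    (0 < r ∧ B = Metric.ball c r) ∨ (0 ≤ r ∧ B = Metric.closedBall c r)

/-!
The members are to be coloured with `κ` colours so that every point sees every colour.

Fix a countable base `B` of the topology. A member whose set is `⋃ i, V i ∩ G i` is labelled, for
each basic set `B b`, by the ideals of those `V i` with `B b ⊆ G i`. For an ideal `W` let `F(W,
b)` (`labelBelow`) be the set of members that have a label below `W` in the block `b`. A point `x`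
with maximal ideal `𝔪` lies exactly in the members of `⋃ F(𝔪, b)`, the union being over the
countably many `b` with `x ∈ B b`. Since `κ` is uncountable, for each colour `γ < κ` one of these
sets is infinite and has more than `|γ|` elements, where `|γ|` is the number of predecessors of
`γ`. So it suffices to colour the members in such a way that every infinite `F(W, b)` receives all
colours `γ` with `|γ| < |F(W, b)|` (`exists_coloring_labelBelow`). This is a statement about
labels in any semilattice that satisfies the ascending chain condition, which for ideals is the
Hilbert basis theorem.

The colouring is built along nested chains of closed sets of labels, colours and members, as with
chains of elementary submodels. The key fact is `IsLabelClosed.exists_color_or_card_lt`. Let `A`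
be closed under suprema and under taking the labels of a member, and let it contain the colours
with fewer than `|A|` predecessors. By Noetherianity, the labels of `A` below `W` have a largest
element `W'`, so that `F(W, b) ∩ A ⊆ F(W', b) ⊆ F(W, b)`. If `F(W, b) ∩ A` is as large as `F(W,
b)`, then so is `F(W', b)`, and the requirement at `W` is already met by the requirement at `W'`
within `A`. Otherwise most of `F(W, b)` lies outside `A`. The same alternative holds for finitely
many closed sets at once, and induction on cardinality extends a colouring from finitely many
closed sets to a further closed set around any prescribed set (`saturationExtends`): a countable
set only poses countably many demands, each with infinitely many candidates left, and an
uncountable one is the union of a continuous chain of smaller sets, whose initial union joins the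
finite list at each step.

Polyhedra and balls, open or closed, are themselves countable unions of relatively open subsets of
varieties, as a closed half-space is an open one together with a hyperplane, and a closed ball is
an open one together with a sphere.
-/

/-! ### Choice principles -/

section Choice

open Set

/-- Dependent choice along a well-order: a function can be built value by value when every
admissible initial part admits a next value. -/
theorem exists_forall_of_initial_segments {I S : Type*} [LinearOrder I] [WellFoundedLT I]
    [Nonempty S] (R : ∀ i : I, (Iio i → S) → S → Prop)
    (h : ∀ (i : I) (t : Iio i → S),
      (∀ j : Iio i, R j (fun k => t ⟨k, lt_trans k.2 j.2⟩) (t j)) → ∃ x, R i t x) :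
    ∃ T : I → S, ∀ i, R i (fun j => T j) (T i) := by
  classical
  let F : ∀ i : I, (∀ j : I, j < i → S) → S :=
    fun i rec => Classical.epsilon (R i (fun j => rec j j.2))
  let T : I → S := (wellFounded_lt (α := I)).fix F
  have hT (i : I) : T i = Classical.epsilon (R i (fun j => T j)) :=
    (wellFounded_lt (α := I)).fix_eq F i
  refine ⟨T, fun i => ?_⟩
  induction i using WellFoundedLT.induction with
  | ind i ih =>
    rw [hT i]
    exact Classical.epsilon_spec (h i (fun j => T j) fun j => ih j j.2)

/-- Countably many infinite sets have a system of distinct representatives. -/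
theorem exists_injective_mem_of_infinite {ι α : Type*} [Countable ι] (T : ι → Set α)
    (hT : ∀ i, (T i).Infinite) : ∃ f : ι → α, Function.Injective f ∧ ∀ i, f i ∈ T i := by
  classical
  obtain ⟨e, he⟩ := exists_injective_nat ι
  choose t htT htc using fun i => (hT i).exists_subset_card_eq (e i + 1)
  have hall : ∀ s : Finset ι, s.card ≤ (s.biUnion t).card := by
    intro s
    rcases s.eq_empty_or_nonempty with rfl | hs
    · simp
    obtain ⟨m, hm, hmax⟩ := s.exists_max_image e hs
    calc s.card = (s.image e).card := (Finset.card_image_of_injective s he).symm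
      _ ≤ (Finset.range (e m + 1)).card := by
        refine Finset.card_le_card fun k hk => ?_
        obtain ⟨i, hi, rfl⟩ := Finset.mem_image.1 hk
        exact Finset.mem_range.2 (Nat.lt_succ_of_le (hmax i hi))
      _ = (t m).card := by rw [Finset.card_range, htc]
      _ ≤ _ := Finset.card_le_card (Finset.subset_biUnion_of_mem t hm)
  obtain ⟨f, hf, hft⟩ := (Finset.all_card_le_biUnion_card_iff_exists_injective t).1 hall
  exact ⟨f, hf, fun i => htT i (hft i)⟩

/-- A countable set has a countable closure under a binary operation with countably many
values. -/
theorem exists_countable_closure {E : Type*} (g : E → E → Set E) (hg : ∀ x y, (g x y).Countable)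
    {Y : Set E} (hY : Y.Countable) :
    ∃ A : Set E, Y ⊆ A ∧ A.Countable ∧ ∀ x ∈ A, ∀ y ∈ A, g x y ⊆ A := by
  let next : Set E → Set E := fun B => B ∪ ⋃ x ∈ B, ⋃ y ∈ B, g x y
  let B : ℕ → Set E := fun k => next^[k] Y
  have hsucc (k : ℕ) : B (k + 1) = next (B k) := Function.iterate_succ_apply' next k Y
  have hmono : Monotone B := monotone_nat_of_le_succ fun k => by
    rw [hsucc]
    exact subset_union_left
  have hcount (k : ℕ) : (B k).Countable := by
    induction k with
    | zero => exact hY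
    | succ k ih =>
      rw [hsucc]
      exact ih.union (ih.biUnion fun x _ => ih.biUnion fun y _ => hg x y)
  refine ⟨⋃ k, B k, subset_iUnion B 0, countable_iUnion hcount, ?_⟩
  intro x hx y hy z hz
  obtain ⟨k, hk⟩ := mem_iUnion.1 hx
  obtain ⟨l, hl⟩ := mem_iUnion.1 hy
  refine mem_iUnion.2 ⟨max k l + 1, ?_⟩
  rw [hsucc]
  refine Or.inr ?_
  simp only [mem_iUnion]
  exact ⟨x, hmono (le_max_left k l) hk, y, hmono (le_max_right k l) hl, hz⟩

end Choice

/-! ### Unions of chains of coloured sets -/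

section Gluing

open Set Cardinal

variable {J K M : Type u}

theorem mk_iUnion_le_of_forall_le {ι E : Type u} {ν : Cardinal.{u}} (hν : ℵ₀ ≤ ν) (hι : #ι ≤ ν)
    (A : ι → Set E) (hA : ∀ i, #(A i) ≤ ν) : #(⋃ i, A i) ≤ ν :=
  (Cardinal.mk_iUnion_le A).trans
    ((mul_le_mul' hι (ciSup_le' hA)).trans (Cardinal.mul_eq_self hν).le)

open Classical in
/-- The common extension of a coherent family of colourings `(t i).2`, each of which matters only
on the objects in `(t i).1`; all other objects keep their colour under `c`. -/
noncomputable def glueColoring {ι : Type u} (t : ι → Set (J ⊕ K ⊕ M) × (M → K)) (c : M → K) :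
    M → K := fun p =>
  if h : ∃ i, Sum.inr (Sum.inr p) ∈ (t i).1 then (t h.choose).2 p else c p

theorem glueColoring_eq {ι : Type u} [LinearOrder ι] (t : ι → Set (J ⊕ K ⊕ M) × (M → K))
    (c : M → K) (hcoh : ∀ i j, i < j → ∀ p, Sum.inr (Sum.inr p) ∈ (t i).1 →
      (t j).2 p = (t i).2 p) (i : ι) (p : M) (hp : Sum.inr (Sum.inr p) ∈ (t i).1) :
    glueColoring t c p = (t i).2 p := by
  have h : ∃ i, Sum.inr (Sum.inr p) ∈ (t i).1 := ⟨i, hp⟩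
  rw [glueColoring, dif_pos h]
  rcases lt_trichotomy h.choose i with hlt | heq | hlt
  · exact (hcoh _ _ hlt p h.choose_spec).symm
  · rw [heq]
  · exact hcoh _ _ hlt p hp

theorem glueColoring_eq_base {ι : Type u} (t : ι → Set (J ⊕ K ⊕ M) × (M → K))
    (c : M → K) (p : M) (h : ∀ i, (t i).2 p = c p) : glueColoring t c p = c p := by
  rw [glueColoring]
  split_ifs
  · exact h _
  · rfl

end Gluing

/-! ### Colouring objects labelled by a Noetherian semilattice -/

section Coloring

open Set Cardinal

variable {J K M : Type u} [SemilatticeSup J] [LinearOrder K]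

/-- The set `F(W, b)`: objects one of whose labels in the block `b` lies below `W`. Here `v p b i`
is the `i`-th label of the object `p` in the block `b`. -/
def labelBelow (v : M → ℕ → ℕ → J) (W : J) (b : ℕ) : Set M := {p | ∃ i, v p b i ≤ W}

theorem labelBelow_mono (v : M → ℕ → ℕ → J) {V W : J} (h : V ≤ W) (b : ℕ) :
    labelBelow v V b ⊆ labelBelow v W b := fun _ ⟨i, hi⟩ => ⟨i, hi.trans h⟩

/-- Sets of labels, colours and objects that are closed under suprema of labels and under passing
from an object to its labels, and that contain every colour with fewer predecessors than the set
has elements. They play the role of elementary submodels. In `J ⊕ K ⊕ M` the summands are the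
labels, the colours and the objects, in this order. -/
structure IsLabelClosed (v : M → ℕ → ℕ → J) (A : Set (J ⊕ K ⊕ M)) : Prop where
  sup_mem : ∀ V W, Sum.inl V ∈ A → Sum.inl W ∈ A → Sum.inl (V ⊔ W) ∈ A
  label_mem : ∀ p, Sum.inr (Sum.inr p) ∈ A → ∀ b i, Sum.inl (v p b i) ∈ A
  color_mem : ∀ γ : K, #(Iio γ) < #A → Sum.inr (Sum.inl γ) ∈ A

/-- Inside `A`, every infinite set `F(W, b)` receives each colour that has fewer than `#F(W, b)`
predecessors. -/
def IsSaturated (v : M → ℕ → ℕ → J) (A : Set (J ⊕ K ⊕ M)) (c : M → K) : Prop :=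
  ∀ (W : J) (γ : K) (b : ℕ), Sum.inl W ∈ A → Sum.inr (Sum.inl γ) ∈ A →
    (labelBelow v W b).Infinite → #(Iio γ) < #(labelBelow v W b) →
    ∃ p, Sum.inr (Sum.inr p) ∈ A ∧ p ∈ labelBelow v W b ∧ c p = γ

/-- Given finitely many closed sets on which a colouring is already saturated, every set of size
at most `μ` extends to a closed set of size at most `μ` that becomes saturated after recolouring
objects outside the given sets. -/
def SaturationExtends (K : Type u) [LinearOrder K] (v : M → ℕ → ℕ → J) (μ : Cardinal.{u}) : Prop :=
  ∀ (L : Set (Set (J ⊕ K ⊕ M))) (c : M → K), L.Finite →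
    (∀ A ∈ L, IsLabelClosed v A ∧ IsSaturated v A c) →
    ∀ Y : Set (J ⊕ K ⊕ M), #Y ≤ μ →
    ∃ (A : Set (J ⊕ K ⊕ M)) (c' : M → K), Y ⊆ A ∧ #A ≤ μ ∧ IsLabelClosed v A ∧
      IsSaturated v A c' ∧ ∀ B ∈ L, ∀ p, Sum.inr (Sum.inr p) ∈ B → c' p = c p

/-- The objects of `F(W, b)` in a closed set `A` lie in `F(W', b)`, where `W'` is the largest label
of `A` below `W`. Hence either `A` uses up only a smaller part of `F(W, b)`, or `F(W', b)` is as
large as `F(W, b)` and already shows the colour inside `A`. -/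
theorem IsLabelClosed.exists_color_or_card_lt [WellFoundedGT J] {v : M → ℕ → ℕ → J}
    {A : Set (J ⊕ K ⊕ M)} {c : M → K} (hA : IsLabelClosed v A) (hc : IsSaturated v A c)
    (W : J) (γ : K) (b : ℕ) (hinf : (labelBelow v W b).Infinite)
    (hγ : #(Iio γ) < #(labelBelow v W b)) :
    (∃ p, Sum.inr (Sum.inr p) ∈ A ∧ p ∈ labelBelow v W b ∧ c p = γ) ∨
      #{p | Sum.inr (Sum.inr p) ∈ A ∧ p ∈ labelBelow v W b} < #(labelBelow v W b) := by
  by_contra! hcon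
  obtain ⟨hno, hle⟩ := hcon
  set U : Set M := {p | Sum.inr (Sum.inr p) ∈ A ∧ p ∈ labelBelow v W b} with hU
  have hUinf : U.Infinite := by
    rw [← Set.infinite_coe_iff, Cardinal.infinite_iff]
    exact (Cardinal.infinite_iff.1 hinf.to_subtype).trans hle
  have hUA : #U ≤ #A :=
    Cardinal.mk_le_of_injective (f := fun p : U => (⟨Sum.inr (Sum.inr p.1), p.2.1⟩ : A))
      fun p q h => by simpa [Subtype.ext_iff] using h
  obtain ⟨p, hpA, i, hi⟩ := hUinf.nonempty
  let S : Set J := {V | Sum.inl V ∈ A ∧ V ≤ W}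
  obtain ⟨W', ⟨hW'A, hW'W⟩, hmax⟩ :=
    (wellFounded_gt (α := J)).has_min S ⟨_, hA.label_mem p hpA b i, hi⟩
  have hgreatest : ∀ V ∈ S, V ≤ W' := by
    intro V hV
    have := hmax (V ⊔ W') ⟨hA.sup_mem _ _ hV.1 hW'A, sup_le hV.2 hW'W⟩
    by_contra hVW
    exact this (right_lt_sup.2 hVW)
  have hUW' : U ⊆ labelBelow v W' b := by
    rintro q ⟨hqA, j, hj⟩
    exact ⟨j, hgreatest _ ⟨hA.label_mem q hqA b j, hj⟩⟩
  obtain ⟨q, hqA, hqW, hqγ⟩ := hc W' γ b hW'A (hA.color_mem γ (hγ.trans_le (hle.trans hUA)))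
    (hUinf.mono hUW') (hγ.trans_le (hle.trans (Cardinal.mk_le_mk_of_subset hUW')))
  exact hno q hqA (labelBelow_mono v hW'W b hqW) hqγ

/-- If no object in the sets of the finite list `L` meets the demand for colour `γ` in `F(W, b)`,
then infinitely many elements of `F(W, b)` are outside these sets: each of them contains a part of
`F(W, b)` of smaller cardinality, and so does their union. -/
theorem labelBelow_diff_infinite [WellFoundedGT J] {v : M → ℕ → ℕ → J}
    {L : Set (Set (J ⊕ K ⊕ M))} {c : M → K} (hL : L.Finite)
    (hLc : ∀ A ∈ L, IsLabelClosed v A ∧ IsSaturated v A c)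
    (W : J) (γ : K) (b : ℕ) (hinf : (labelBelow v W b).Infinite)
    (hγ : #(Iio γ) < #(labelBelow v W b))
    (hno : ¬ ∃ p, (∃ A ∈ L, Sum.inr (Sum.inr p) ∈ A) ∧ p ∈ labelBelow v W b ∧ c p = γ) :
    (labelBelow v W b \ {p | ∃ A ∈ L, Sum.inr (Sum.inr p) ∈ A}).Infinite := by
  have hsmall : ∀ A ∈ L,
      #{p | Sum.inr (Sum.inr p) ∈ A ∧ p ∈ labelBelow v W b} < #(labelBelow v W b) := by
    intro A hA
    refine ((hLc A hA).1.exists_color_or_card_lt (hLc A hA).2 W γ b hinf hγ).resolve_left ?_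
    rintro ⟨p, hpA, hp⟩
    exact hno ⟨p, ⟨A, hA, hpA⟩, hp⟩
  have hω := Cardinal.infinite_iff.1 hinf.to_subtype
  have hunion : ∀ L' ⊆ L, L'.Finite →
      #{p | (∃ A ∈ L', Sum.inr (Sum.inr p) ∈ A) ∧ p ∈ labelBelow v W b} <
        #(labelBelow v W b) := by
    intro L' hL' hfin
    induction L', hfin using Set.Finite.induction_on with
    | empty => simpa [pos_iff_ne_zero, Cardinal.mk_ne_zero_iff] using hinf.nonempty.to_subtype
    | @insert B L' _ _ ih =>
      refine (Cardinal.mk_le_mk_of_subset (t := {p | Sum.inr (Sum.inr p) ∈ B ∧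
        p ∈ labelBelow v W b} ∪ {p | (∃ A ∈ L', Sum.inr (Sum.inr p) ∈ A) ∧
        p ∈ labelBelow v W b}) ?_).trans_lt ((Cardinal.mk_union_le _ _).trans_lt
          (Cardinal.add_lt_of_lt hω (hsmall B (hL' (mem_insert _ _)))
            (ih ((subset_insert _ _).trans hL'))))
      rintro p ⟨⟨A, hA, hpA⟩, hp⟩
      rcases hA with rfl | hA
      · exact Or.inl ⟨hpA, hp⟩
      · exact Or.inr ⟨⟨A, hA, hpA⟩, hp⟩
  intro hfin
  refine (hunion L subset_rfl hL).not_ge ?_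
  by_contra! hlt
  have h2 := Cardinal.add_lt_of_lt hω
    ((Cardinal.lt_aleph0_iff_set_finite.2 hfin).trans_le hω) hlt
  refine (h2.trans_le' ((Cardinal.mk_le_mk_of_subset ?_).trans (Cardinal.mk_union_le _ _))).false
  intro p hp
  by_cases h : ∃ A ∈ L, Sum.inr (Sum.inr p) ∈ A
  · exact Or.inr ⟨h, hp⟩
  · exact Or.inl ⟨hp, h⟩

theorem countable_setOf_finite_Iio (K : Type u) [LinearOrder K] :
    {γ : K | #(Iio γ) < ℵ₀}.Countable := by
  have hlt : ∀ γ δ : K, #(Iio δ) < ℵ₀ → γ < δ → (Iio γ).ncard < (Iio δ).ncard :=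
    fun γ δ hδ hγδ => ncard_lt_ncard (Iio_ssubset_Iio hγδ)
      (Cardinal.lt_aleph0_iff_set_finite.1 hδ)
  refine MapsTo.countable_of_injOn (f := fun γ : K => (Iio γ).ncard) (mapsTo_univ _ _) ?_
    countable_univ
  intro γ hγ δ hδ h
  rcases lt_trichotomy γ δ with hlt' | heq | hlt'
  · exact absurd h (hlt γ δ hδ hlt').ne
  · exact heq
  · exact absurd h (hlt δ γ hγ hlt').ne'

/-- The countable case: only countably many demands are left open, and each of them has infinitely
many candidates outside the given sets. -/
theorem saturationExtends_aleph0 [WellFoundedGT J] (v : M → ℕ → ℕ → J) :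
    SaturationExtends K v ℵ₀ := by
  classical
  intro L c hL hLc Y hY
  let used : Set M := {p | ∃ A ∈ L, Sum.inr (Sum.inr p) ∈ A}
  -- `T W b` is a countable reservoir of unused members of `F(W, b)`
  have hT : ∀ (W : J) (b : ℕ), ∃ T : Set M, T.Countable ∧ T ⊆ labelBelow v W b \ used ∧
      ((labelBelow v W b \ used).Infinite → T.Infinite) := by
    intro W b
    by_cases h : (labelBelow v W b \ used).Infinite
    · refine ⟨range fun k => (h.natEmbedding _ k : M), countable_range _, ?_, fun _ => ?_⟩
      · rintro _ ⟨k, rfl⟩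
        exact (h.natEmbedding _ k).2
      · exact infinite_range_of_injective
          (Subtype.val_injective.comp (h.natEmbedding _).injective)
    · exact ⟨∅, countable_empty, empty_subset _, fun h' => (h h').elim⟩
  choose T hTc hTsub hTinf using hT
  -- `Q W γ b` is a used member of `F(W, b)` of colour `γ`, if there is one
  have hQ : ∀ (W : J) (γ : K) (b : ℕ), ∃ Q : Set M, Q.Countable ∧
      ((∃ p, p ∈ used ∧ p ∈ labelBelow v W b ∧ c p = γ) →
        ∃ p ∈ Q, p ∈ used ∧ p ∈ labelBelow v W b ∧ c p = γ) := by
    intro W γ b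
    by_cases h : ∃ p, p ∈ used ∧ p ∈ labelBelow v W b ∧ c p = γ
    · obtain ⟨p, hp⟩ := h
      exact ⟨{p}, countable_singleton p, fun _ => ⟨p, rfl, hp⟩⟩
    · exact ⟨∅, countable_empty, fun h' => (h h').elim⟩
  choose Q hQc hQmem using hQ
  -- the operation under which the countable set is closed
  let obj : M → J ⊕ K ⊕ M := fun p => Sum.inr (Sum.inr p)
  let g : J ⊕ K ⊕ M → J ⊕ K ⊕ M → Set (J ⊕ K ⊕ M)
    | Sum.inl V, Sum.inl W => {Sum.inl (V ⊔ W)} ∪ ⋃ b, obj '' T V b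
    | Sum.inl W, Sum.inr (Sum.inl γ) => ⋃ b, obj '' Q W γ b
    | Sum.inr (Sum.inr p), _ => ⋃ b, range fun i => Sum.inl (v p b i)
    | _, _ => ∅
  have hg : ∀ x y, (g x y).Countable := by
    rintro (V | γ | p) (W | δ | q)
    · exact (countable_singleton _).union (countable_iUnion fun b => (hTc V b).image _)
    · exact countable_iUnion fun b => (hQc V δ b).image _
    · exact countable_empty
    · exact countable_empty
    · exact countable_empty
    · exact countable_empty
    all_goals exact countable_iUnion fun b => countable_range _
  obtain ⟨A, hYA, hAc, hAg⟩ := exists_countable_closure g hg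
    (((Cardinal.le_aleph0_iff_set_countable.1 hY)).union
      ((countable_setOf_finite_Iio K).image fun γ => (Sum.inr (Sum.inl γ) : J ⊕ K ⊕ M)))
  have hT_mem : ∀ W b, Sum.inl W ∈ A → ∀ p ∈ T W b, Sum.inr (Sum.inr p) ∈ A := by
    intro W b hW p hp
    exact hAg _ hW _ hW (Or.inr (mem_iUnion.2 ⟨b, p, hp, rfl⟩))
  have hQ_mem : ∀ W γ b, Sum.inl W ∈ A → Sum.inr (Sum.inl γ) ∈ A → ∀ p ∈ Q W γ b,
      Sum.inr (Sum.inr p) ∈ A := by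
    intro W γ b hW hγ p hp
    exact hAg _ hW _ hγ (mem_iUnion.2 ⟨b, p, hp, rfl⟩)
  -- the demands that no member of `used` meets
  let D : Set (J × K × ℕ) := {d | (Sum.inl d.1 ∈ A ∧ Sum.inr (Sum.inl d.2.1) ∈ A) ∧
    (T d.1 d.2.2).Infinite}
  have hDc : Countable D := by
    have h1 : {W : J | Sum.inl W ∈ A}.Countable := hAc.preimage Sum.inl_injective
    have h2 : {γ : K | Sum.inr (Sum.inl γ) ∈ A}.Countable :=
      hAc.preimage (Sum.inr_injective.comp Sum.inl_injective)
    refine ((h1.prod (h2.prod (countable_univ (α := ℕ)))).mono ?_).to_subtype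
    rintro ⟨W, γ, b⟩ ⟨⟨hW, hγ⟩, -⟩
    exact ⟨hW, hγ, mem_univ _⟩
  obtain ⟨f, hfinj, hfT⟩ := exists_injective_mem_of_infinite
    (fun d : D => T d.1.1 d.1.2.2) fun d => d.2.2
  let c' : M → K := fun p => if h : ∃ d, f d = p then h.choose.1.2.1 else c p
  have hc'f : ∀ d, c' (f d) = d.1.2.1 := by
    intro d
    have h : ∃ d', f d' = f d := ⟨d, rfl⟩
    have : h.choose = d := hfinj h.choose_spec
    simp only [c', dif_pos h, this]
  have hc'used : ∀ p ∈ used, c' p = c p := by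
    intro p hp
    refine dif_neg ?_
    rintro ⟨d, rfl⟩
    exact (hTsub _ _ (hfT d)).2 hp
  refine ⟨A, c', subset_union_left.trans hYA, Cardinal.le_aleph0_iff_set_countable.2 hAc,
    ⟨?_, ?_, ?_⟩, ?_, ?_⟩
  · intro V W hV hW
    exact hAg _ hV _ hW (Or.inl rfl)
  · intro p hp b i
    exact hAg _ hp _ hp (mem_iUnion.2 ⟨b, i, rfl⟩)
  · intro γ hγ
    exact hYA (Or.inr ⟨γ, hγ.trans_le (Cardinal.le_aleph0_iff_set_countable.2 hAc), rfl⟩)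
  · intro W γ b hW hγ hinf hlt
    by_cases h : ∃ p, p ∈ used ∧ p ∈ labelBelow v W b ∧ c p = γ
    · obtain ⟨p, hpQ, hpu, hpW, hpγ⟩ := hQmem W γ b h
      exact ⟨p, hQ_mem W γ b hW hγ p hpQ, hpW, (hc'used p hpu).trans hpγ⟩
    · have hTi := hTinf W b (labelBelow_diff_infinite hL hLc W γ b hinf hlt h)
      let d : D := ⟨(W, γ, b), ⟨hW, hγ⟩, hTi⟩
      exact ⟨f d, hT_mem W b hW _ (hfT d), (hTsub _ _ (hfT d)).1, hc'f d⟩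
  · intro B hB p hp
    exact hc'used p ⟨B, hB, hp⟩

theorem isLabelClosed_iUnion {ι : Type u} [LinearOrder ι] (v : M → ℕ → ℕ → J)
    (A : ι → Set (J ⊕ K ⊕ M)) (hmono : Monotone A) (hA : ∀ i, IsLabelClosed v (A i))
    (hcol : ∀ γ : K, #(Iio γ) < #(⋃ i, A i) → ∃ i, Sum.inr (Sum.inl γ) ∈ A i) :
    IsLabelClosed v (⋃ i, A i) where
  sup_mem V W hV hW := by
    obtain ⟨i, hi⟩ := mem_iUnion.1 hV
    obtain ⟨j, hj⟩ := mem_iUnion.1 hW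
    exact mem_iUnion.2 ⟨max i j, (hA _).sup_mem _ _ (hmono (le_max_left i j) hi)
      (hmono (le_max_right i j) hj)⟩
  label_mem p hp b k := by
    obtain ⟨i, hi⟩ := mem_iUnion.1 hp
    exact mem_iUnion.2 ⟨i, (hA i).label_mem p hi b k⟩
  color_mem γ hγ := mem_iUnion.2 (hcol γ hγ)

theorem isSaturated_iUnion {ι : Type u} [LinearOrder ι] (v : M → ℕ → ℕ → J)
    (A : ι → Set (J ⊕ K ⊕ M)) (c : ι → M → K) (c' : M → K) (hmono : Monotone A)
    (hA : ∀ i, IsSaturated v (A i) (c i))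
    (hc : ∀ i p, Sum.inr (Sum.inr p) ∈ A i → c' p = c i p) :
    IsSaturated v (⋃ i, A i) c' := by
  intro W γ b hW hγ hinf hlt
  obtain ⟨i, hi⟩ := mem_iUnion.1 hW
  obtain ⟨j, hj⟩ := mem_iUnion.1 hγ
  obtain ⟨p, hp, hpW, hpγ⟩ := hA (max i j) W γ b (hmono (le_max_left i j) hi)
    (hmono (le_max_right i j) hj) hinf hlt
  exact ⟨p, mem_iUnion.2 ⟨_, hp⟩, hpW, (hc _ p hp).trans hpγ⟩

/-- The uncountable case: the set is exhausted by a continuous chain of shorter sets. Each step of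
the chain is an instance for a smaller cardinal, with the union of the earlier sets added to the
finite list of sets that must keep their colours. -/
theorem saturationExtends_of_lt [WellFoundedLT K] (v : M → ℕ → ℕ → J) {μ : Cardinal.{u}}
    (hμ : ℵ₀ < μ) (ih : ∀ ν, ℵ₀ ≤ ν → ν < μ → SaturationExtends K v ν) :
    SaturationExtends K v μ := by
  intro L c hL hLc Y hY
  let I := μ.ord.ToType
  have hI : #I = μ := Cardinal.mk_ord_toType μ
  have hIio (i : I) : #(Iio i) < μ := by
    simpa [I] using Cardinal.mk_Iio_lt i (by simp [I])
  let ν : I → Cardinal.{u} := fun i => max #(Iio i) ℵ₀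
  have hν (i : I) : ν i < μ := max_lt (hIio i) hμ
  have hνω (i : I) : ℵ₀ ≤ ν i := le_max_right _ _
  have hνmono : Monotone ν := fun i j hij =>
    max_le_max (Cardinal.mk_le_mk_of_subset (Iio_subset_Iio hij)) le_rfl
  obtain ⟨e⟩ : Nonempty (Y ↪ I) := by
    rw [← Cardinal.le_def, hI]
    exact hY
  -- `y i`: the `i`-th element of `Y`, the `i`-th colour and all colours with finitely many
  -- predecessors; listing colours in order makes every initial union satisfy `color_mem`
  let y : I → Set (J ⊕ K ⊕ M) := fun i =>
    (((↑) : Y → J ⊕ K ⊕ M) '' (e ⁻¹' {i}) ∪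
      (fun γ => Sum.inr (Sum.inl γ)) '' {γ : K | #(Iio γ) < ℵ₀}) ∪
      (fun γ => Sum.inr (Sum.inl γ)) '' {γ : K |
        Ordinal.typein (α := K) (· < ·) γ = Ordinal.typein (α := I) (· < ·) i}
  have hyc (i : I) : #(y i) ≤ ℵ₀ := by
    rw [Cardinal.le_aleph0_iff_set_countable]
    refine (Countable.union ?_ ?_).union ?_
    · refine (Set.Subsingleton.countable ?_).image _
      exact subsingleton_singleton.preimage e.injective
    · exact (countable_setOf_finite_Iio K).image _
    · refine (Set.Subsingleton.countable ?_).image _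
      intro γ hγ δ hδ
      exact (Ordinal.typein_inj (· < ·)).1 (hγ.trans hδ.symm)
  have hcolor : ∀ γ : K, #(Iio γ) < μ → ∃ i, Sum.inr (Sum.inl γ) ∈ y i ∧
      #(Iio i) = #(Iio γ) := by
    intro γ hγ
    have ho : Ordinal.typein (α := K) (· < ·) γ < μ.ord := by
      rw [Cardinal.lt_ord, Ordinal.card_typein]
      exact hγ
    obtain ⟨i, hi⟩ : ∃ i : I, Ordinal.typein (α := I) (· < ·) i =
        Ordinal.typein (α := K) (· < ·) γ :=
      Ordinal.typein_surj (· < ·) (by rwa [Ordinal.type_toType])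
    refine ⟨i, Or.inr ⟨γ, hi.symm, rfl⟩, ?_⟩
    have := congrArg Ordinal.card hi
    rwa [Ordinal.card_typein, Ordinal.card_typein] at this
  let R : ∀ i : I, (Iio i → Set (J ⊕ K ⊕ M) × (M → K)) → Set (J ⊕ K ⊕ M) × (M → K) → Prop :=
    fun i t x => ((∀ j, (t j).1 ⊆ x.1) ∧ y i ⊆ x.1 ∧ #x.1 ≤ ν i) ∧
      (IsLabelClosed v x.1 ∧ IsSaturated v x.1 x.2) ∧
      (∀ B ∈ L, ∀ p, Sum.inr (Sum.inr p) ∈ B → x.2 p = c p) ∧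
      ∀ j p, Sum.inr (Sum.inr p) ∈ (t j).1 → x.2 p = (t j).2 p
  obtain ⟨T, hT⟩ : ∃ T : I → Set (J ⊕ K ⊕ M) × (M → K), ∀ i, R i (fun j => T j) (T i) := by
    have : Nonempty (Set (J ⊕ K ⊕ M) × (M → K)) := ⟨(∅, c)⟩
    refine exists_forall_of_initial_segments R fun i t ht => ?_
    have hmono : Monotone fun j => (t j).1 := by
      refine monotone_iff_forall_lt.2 fun j k hjk => ?_
      exact (ht k).1.1 ⟨j, hjk⟩
    have hcoh : ∀ j k, j < k → ∀ p, Sum.inr (Sum.inr p) ∈ (t j).1 → (t k).2 p = (t j).2 p :=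
      fun j k hjk p hp => (ht k).2.2.2 ⟨j, hjk⟩ p hp
    have hcard : #(⋃ j, (t j).1) ≤ ν i := mk_iUnion_le_of_forall_le (hνω i) (le_max_left _ _) _
      fun j => (ht j).1.2.2.trans (hνmono (le_of_lt j.2))
    have hglue := glueColoring_eq t c hcoh
    have hglueL : ∀ B ∈ L, ∀ p, Sum.inr (Sum.inr p) ∈ B → glueColoring t c p = c p :=
      fun B hB p hp => glueColoring_eq_base t c p fun j => (ht j).2.2.1 B hB p hp
    have hclosed : IsLabelClosed v (⋃ j, (t j).1) := by
      refine isLabelClosed_iUnion v _ hmono (fun j => (ht j).2.1.1) fun γ hγ => ?_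
      rcases lt_max_iff.1 (hγ.trans_le hcard) with hlt | hlt
      · obtain ⟨j, hj, hjγ⟩ := hcolor γ (hlt.trans (hIio i))
        have hji : j < i := by
          by_contra! hij
          exact (hlt.trans_le (Cardinal.mk_le_mk_of_subset (Iio_subset_Iio hij))).ne hjγ.symm
        exact ⟨⟨j, hji⟩, (ht ⟨j, hji⟩).1.2.1 hj⟩
      · have hne : (⋃ j, (t j).1).Nonempty := by
          rw [← Set.nonempty_coe_sort, ← Cardinal.mk_ne_zero_iff]
          exact (pos_of_gt hγ).ne'
        obtain ⟨x, hx⟩ := hne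
        obtain ⟨j, -⟩ := mem_iUnion.1 hx
        exact ⟨j, (ht j).1.2.1 (Or.inl (Or.inr ⟨γ, hlt, rfl⟩))⟩
    have hsat : IsSaturated v (⋃ j, (t j).1) (glueColoring t c) :=
      isSaturated_iUnion v _ _ _ hmono (fun j => (ht j).2.1.2) hglue
    obtain ⟨A, c', hYA, hAν, hAcl, hAsat, hAL⟩ := ih (ν i) (hνω i) (hν i)
      (insert (⋃ j, (t j).1) L) (glueColoring t c) (hL.insert _)
      (by
        rintro B (rfl | hB)
        · exact ⟨hclosed, hsat⟩
        · refine ⟨(hLc B hB).1, fun W γ b hW hγ hinf hlt => ?_⟩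
          obtain ⟨p, hp, hpW, hpγ⟩ := (hLc B hB).2 W γ b hW hγ hinf hlt
          exact ⟨p, hp, hpW, (hglueL B hB p hp).trans hpγ⟩)
      ((⋃ j, (t j).1) ∪ y i)
      ((Cardinal.mk_union_le _ _).trans
        (Cardinal.add_le_of_le (hνω i) hcard ((hyc i).trans (hνω i))))
    refine ⟨(A, c'), ⟨fun j => ?_, subset_union_right.trans hYA, hAν⟩, ⟨hAcl, hAsat⟩, ?_, ?_⟩
    · exact (subset_iUnion (fun j => (t j).1) j).trans (subset_union_left.trans hYA)
    · intro B hB p hp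
      exact (hAL B (mem_insert_of_mem _ hB) p hp).trans (hglueL B hB p hp)
    · intro j p hp
      exact (hAL _ (mem_insert _ _) p (mem_iUnion.2 ⟨j, hp⟩)).trans (hglue j p hp)
  have hmono : Monotone fun j => (T j).1 :=
    monotone_iff_forall_lt.2 fun j k hjk => (hT k).1.1 ⟨j, hjk⟩
  have hglue := glueColoring_eq T c fun j k hjk p hp => (hT k).2.2.2 ⟨j, hjk⟩ p hp
  have hcard : #(⋃ j, (T j).1) ≤ μ := mk_iUnion_le_of_forall_le hμ.le hI.le _
    fun j => (hT j).1.2.2.trans (hν j).le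
  refine ⟨⋃ j, (T j).1, glueColoring T c, ?_, hcard, ?_, ?_, ?_⟩
  · intro x hx
    exact mem_iUnion.2 ⟨e ⟨x, hx⟩, (hT _).1.2.1 (Or.inl (Or.inl ⟨⟨x, hx⟩, rfl, rfl⟩))⟩
  · refine isLabelClosed_iUnion v _ hmono (fun j => (hT j).2.1.1) fun γ hγ => ?_
    obtain ⟨i, hi, -⟩ := hcolor γ (hγ.trans_le hcard)
    exact ⟨i, (hT i).1.2.1 hi⟩
  · exact isSaturated_iUnion v _ _ _ hmono (fun j => (hT j).2.1.2) hglue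
  · exact fun B hB p hp => glueColoring_eq_base T c p fun j => (hT j).2.2.1 B hB p hp

theorem saturationExtends [WellFoundedGT J] [WellFoundedLT K] (v : M → ℕ → ℕ → J)
    (μ : Cardinal.{u}) (hμ : ℵ₀ ≤ μ) : SaturationExtends K v μ := by
  induction μ using WellFoundedLT.induction with
  | ind μ ih =>
    rcases hμ.eq_or_lt with rfl | hlt
    · exact saturationExtends_aleph0 v
    · exact saturationExtends_of_lt v hlt fun ν hν hνμ => ih ν hνμ hν

/-- There is a colouring of the objects under which every infinite set `F(W, b)` receives each
colour that has fewer than `#F(W, b)` predecessors. -/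
theorem exists_coloring_labelBelow [WellFoundedGT J] [WellFoundedLT K] [Nonempty K]
    (v : M → ℕ → ℕ → J) : ∃ c : M → K, ∀ (W : J) (γ : K) (b : ℕ),
      (labelBelow v W b).Infinite → #(Iio γ) < #(labelBelow v W b) →
      ∃ p ∈ labelBelow v W b, c p = γ := by
  obtain ⟨γ₀⟩ := ‹Nonempty K›
  obtain ⟨A, c, hA, -, -, hsat, -⟩ := saturationExtends (K := K) v
    (max ℵ₀ #(J ⊕ K ⊕ M)) (le_max_left _ _) ∅ (fun _ => γ₀) finite_empty
    (fun _ h => h.elim) univ (by rw [Cardinal.mk_univ]; exact le_max_right _ _)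
  refine ⟨c, fun W γ b hinf hlt => ?_⟩
  obtain ⟨p, -, hp⟩ := hsat W γ b (hA (mem_univ _)) (hA (mem_univ _)) hinf hlt
  exact ⟨p, hp⟩

end Coloring

/-! ### From colourings of the members to partitions into subcovers -/

/-- A colouring of the members with `κ` colours such that every point sees all colours splits the
cover into its `κ` colour classes. -/
theorem MultiCover.SplitsInto.of_coloring {X : Type} [Nonempty X] {C : MultiCover.{u} X}
    {κ : Cardinal.{u}} {K : Type u} (hK : Cardinal.mk K = κ) (c : C.Member → K)
    (hc : ∀ x γ, ∃ p ∈ C.membersAt x, c p = γ) : C.SplitsInto κ := by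
  obtain ⟨x₀⟩ := ‹Nonempty X›
  have hinj : Function.Injective fun γ => c ⁻¹' {γ} := by
    intro γ δ h
    obtain ⟨p, -, hp⟩ := hc x₀ γ
    have h' : c ⁻¹' {γ} = c ⁻¹' {δ} := h
    have : p ∈ c ⁻¹' {δ} := h' ▸ hp
    exact hp.symm.trans this
  refine ⟨Set.range fun γ => c ⁻¹' {γ}, ⟨?_, fun p => ?_⟩, ?_, ?_⟩
  · rintro ⟨γ, hγ⟩
    obtain ⟨p, -, hp⟩ := hc x₀ γ
    have : p ∈ (∅ : Set C.Member) := hγ ▸ hp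
    exact this
  · refine ⟨c ⁻¹' {c p}, ⟨⟨c p, rfl⟩, rfl⟩, ?_⟩
    rintro _ ⟨⟨γ, rfl⟩, hp⟩
    have : c p = γ := hp
    rw [this]
  · rw [Cardinal.mk_range_eq _ hinj, hK]
  · rintro _ ⟨γ, rfl⟩ x
    obtain ⟨p, hpx, hp⟩ := hc x γ
    exact ⟨p, hp, hpx⟩

/-! ### Covers by countable unions of relatively open subsets of varieties -/

section Variety

open Set MvPolynomial

variable {n : ℕ}

theorem mem_zeroLocus_iff_le_vanishingIdeal {I : Ideal (MvPolynomial (Fin n) ℝ)}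
    {x : Fin n → ℝ} : x ∈ zeroLocus ℝ I ↔ I ≤ vanishingIdeal ℝ {x} := by
  simp [SetLike.le_def]

/-- Membership in `H` read off from the maximal ideal of a point and a countable base `B`: the
ideals `w b i` are those of the varieties `V i` with `B b ⊆ G i`. -/
theorem IsCountableUnionOfRelOpen.exists_ideals {H : Set (EuclideanSpace ℝ (Fin n))}
    (hH : IsCountableUnionOfRelOpen H) (B : ℕ → Set (EuclideanSpace ℝ (Fin n)))
    (hB : TopologicalSpace.IsTopologicalBasis (range B)) :
    ∃ w : ℕ → ℕ → Ideal (MvPolynomial (Fin n) ℝ), ∀ x : EuclideanSpace ℝ (Fin n),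
      x ∈ H ↔ ∃ b, x ∈ B b ∧ ∃ i, w b i ≤ vanishingIdeal ℝ {fun j => x j} := by
  classical
  obtain ⟨V, G, hV, hG, rfl⟩ := hH
  choose I hI using hV
  have hVI (i : ℕ) (x : EuclideanSpace ℝ (Fin n)) :
      x ∈ V i ↔ I i ≤ vanishingIdeal ℝ {fun j => x j} := by
    rw [hI i, mem_ofPred_eq, mem_zeroLocus_iff_le_vanishingIdeal]
  -- the label `⊤`, the ideal of the empty variety, is contained in no maximal ideal
  refine ⟨fun b i => if B b ⊆ G i then I i else ⊤, fun x => ⟨fun hx => ?_, ?_⟩⟩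
  · obtain ⟨i, hxV, hxG⟩ := mem_iUnion.1 hx
    obtain ⟨_, ⟨b, rfl⟩, hxb, hbG⟩ := hB.exists_subset_of_mem_open hxG (hG i)
    exact ⟨b, hxb, i, by simpa only [if_pos hbG] using (hVI i x).1 hxV⟩
  · rintro ⟨b, hxb, i, hi⟩
    dsimp only at hi
    split_ifs at hi with hbG
    · exact mem_iUnion.2 ⟨i, (hVI i x).2 hi, hbG hxb⟩
    · have h1 := (mem_vanishingIdeal_singleton_iff _ _).1
        (hi (Submodule.mem_top (x := (1 : MvPolynomial (Fin n) ℝ))))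
      simp at h1

/-- The members containing `x` are the union, over the basic sets `B b` around `x`, of the sets
`F(𝔪, b)` with `𝔪` the maximal ideal of `x`. As `κ` is uncountable, for each colour one of these
countably many sets is large enough to receive it. -/
theorem MultiCover.IsFoldCover.splitsInto {κ : Cardinal.{u}} (hκ : Cardinal.aleph0 < κ)
    {C : MultiCover.{u} (EuclideanSpace ℝ (Fin n))} (hC : C.IsFoldCover κ)
    (hH : ∀ H ∈ C.sets, IsCountableUnionOfRelOpen H) : C.SplitsInto κ := by
  obtain ⟨𝓑, h𝓑c, -, h𝓑⟩ :=
    TopologicalSpace.exists_countable_basis (EuclideanSpace ℝ (Fin n))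
  obtain ⟨B, rfl⟩ : ∃ B : ℕ → Set (EuclideanSpace ℝ (Fin n)), 𝓑 = range B := by
    refine h𝓑c.exists_eq_range ?_
    obtain ⟨s, hs, -⟩ := h𝓑.exists_subset_of_mem_open (mem_univ 0) isOpen_univ
    exact ⟨s, hs⟩
  choose w hw using fun p : C.Member => (hH p.1 p.1.2).exists_ideals B h𝓑
  -- labels are ideals, so larger labels have smaller varieties
  let v : C.Member → ℕ → ℕ → ULift.{u} (Ideal (MvPolynomial (Fin n) ℝ)) :=
    fun p b i => ULift.up (w p b i)
  have hne : κ.ord ≠ 0 := by simpa using (Cardinal.aleph0_pos.trans hκ).ne'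
  have : Nonempty κ.ord.ToType := Ordinal.nonempty_toType_iff.2 hne
  obtain ⟨c, hc⟩ := exists_coloring_labelBelow (K := κ.ord.ToType) v
  refine MultiCover.SplitsInto.of_coloring (Cardinal.mk_ord_toType κ) c fun x γ => ?_
  let 𝔪 : ULift.{u} (Ideal (MvPolynomial (Fin n) ℝ)) :=
    ULift.up (vanishingIdeal ℝ {fun j => x j})
  have hmem (p : C.Member) : p ∈ C.membersAt x ↔ ∃ b, x ∈ B b ∧ p ∈ labelBelow v 𝔪 b := hw p x
  set ν := max (Cardinal.mk (Iio γ)) Cardinal.aleph0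
  have hνκ : ν < κ := max_lt (by simpa using Cardinal.mk_Iio_lt γ (by simp)) hκ
  -- one of the countably many sets whose union is `membersAt x` has more than `ν` elements
  obtain ⟨b, hxb, hb⟩ : ∃ b, x ∈ B b ∧ ν < Cardinal.mk (labelBelow v 𝔪 b) := by
    by_contra! hsmall
    refine hνκ.not_ge ((hC x).trans ((Cardinal.mk_le_mk_of_subset ?_).trans
      (mk_iUnion_le_of_forall_le (ι := ULift.{u} ℕ) (le_max_right _ _) ?_
        (fun b => {p | x ∈ B b.down ∧ p ∈ labelBelow v 𝔪 b.down}) fun b => ?_)))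
    · intro p hp
      obtain ⟨b, hb⟩ := (hmem p).1 hp
      exact mem_iUnion.2 ⟨ULift.up b, hb⟩
    · simp
    · by_cases hxb : x ∈ B b.down
      · exact (Cardinal.mk_le_mk_of_subset fun p hp => hp.2).trans (hsmall _ hxb)
      · simp [hxb]
  obtain ⟨p, hp, hpγ⟩ := hc 𝔪 γ b
    (Set.infinite_coe_iff.1 (Cardinal.infinite_iff.2 ((le_max_right _ _).trans hb.le)))
    ((le_max_left _ _).trans_lt hb)
  exact ⟨p, (hmem p).2 ⟨b, hxb, hp⟩, hpγ⟩

/-! ### Polyhedra and balls -/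

theorem isRealAffineVariety_univ : IsRealAffineVariety (univ : Set (EuclideanSpace ℝ (Fin n))) :=
  ⟨⊥, by simp⟩

theorem IsRealAffineVariety.inter {V W : Set (EuclideanSpace ℝ (Fin n))}
    (hV : IsRealAffineVariety V) (hW : IsRealAffineVariety W) : IsRealAffineVariety (V ∩ W) := by
  obtain ⟨I, rfl⟩ := hV
  obtain ⟨J, rfl⟩ := hW
  refine ⟨I ⊔ J, ?_⟩
  ext x
  simp only [mem_inter_iff, mem_ofPred_eq, mem_zeroLocus_iff_le_vanishingIdeal, sup_le_iff]

theorem isRealAffineVariety_setOf_eval_eq_zero (f : MvPolynomial (Fin n) ℝ) :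
    IsRealAffineVariety {x : EuclideanSpace ℝ (Fin n) | eval (fun i => x i) f = 0} := by
  refine ⟨Ideal.span {f}, ?_⟩
  ext x
  rw [mem_ofPred_eq, mem_ofPred_eq, mem_zeroLocus_iff_le_vanishingIdeal, Ideal.span_le,
    singleton_subset_iff, SetLike.mem_coe, mem_vanishingIdeal_singleton_iff]
  rfl

theorem isCountableUnionOfRelOpen_iUnion {ι : Type*} [Countable ι]
    {V G : ι → Set (EuclideanSpace ℝ (Fin n))} (hV : ∀ i, IsRealAffineVariety (V i))
    (hG : ∀ i, IsOpen (G i)) : IsCountableUnionOfRelOpen (⋃ i, V i ∩ G i) := by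
  rcases isEmpty_or_nonempty ι with h | h
  · exact ⟨fun _ => univ, fun _ => ∅, fun _ => isRealAffineVariety_univ, fun _ => isOpen_empty,
      by simp⟩
  · obtain ⟨e, he⟩ := exists_surjective_nat ι
    exact ⟨V ∘ e, G ∘ e, fun i => hV _, fun i => hG _,
      (he.iUnion_comp fun i => V i ∩ G i).symm⟩

theorem IsCountableUnionOfRelOpen.iUnion {ι : Type*} [Countable ι]
    {H : ι → Set (EuclideanSpace ℝ (Fin n))} (hH : ∀ i, IsCountableUnionOfRelOpen (H i)) :
    IsCountableUnionOfRelOpen (⋃ i, H i) := by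
  choose V G hV hG hVG using hH
  have : (⋃ i, H i) = ⋃ k : ι × ℕ, V k.1 k.2 ∩ G k.1 k.2 := by
    rw [iUnion_prod']
    exact iUnion_congr hVG
  rw [this]
  exact isCountableUnionOfRelOpen_iUnion (fun k => hV _ _) fun k => hG _ _

theorem IsCountableUnionOfRelOpen.union {H₁ H₂ : Set (EuclideanSpace ℝ (Fin n))}
    (h₁ : IsCountableUnionOfRelOpen H₁) (h₂ : IsCountableUnionOfRelOpen H₂) :
    IsCountableUnionOfRelOpen (H₁ ∪ H₂) := by
  rw [union_eq_iUnion]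
  exact .iUnion (by simp [h₁, h₂])

theorem IsCountableUnionOfRelOpen.inter {H₁ H₂ : Set (EuclideanSpace ℝ (Fin n))}
    (h₁ : IsCountableUnionOfRelOpen H₁) (h₂ : IsCountableUnionOfRelOpen H₂) :
    IsCountableUnionOfRelOpen (H₁ ∩ H₂) := by
  obtain ⟨V, G, hV, hG, rfl⟩ := h₁
  obtain ⟨W, U, hW, hU, rfl⟩ := h₂
  have : (⋃ i, V i ∩ G i) ∩ (⋃ i, W i ∩ U i) =
      ⋃ k : ℕ × ℕ, (V k.1 ∩ W k.2) ∩ (G k.1 ∩ U k.2) := by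
    rw [iUnion_inter_iUnion, iUnion_prod']
    exact iUnion_congr fun i => iUnion_congr fun j => inter_inter_inter_comm _ _ _ _
  rw [this]
  exact isCountableUnionOfRelOpen_iUnion (fun k => (hV _).inter (hW _))
    fun k => (hG _).inter (hU _)

theorem IsOpen.isCountableUnionOfRelOpen {G : Set (EuclideanSpace ℝ (Fin n))} (hG : IsOpen G) :
    IsCountableUnionOfRelOpen G :=
  ⟨fun _ => univ, fun _ => G, fun _ => isRealAffineVariety_univ, fun _ => hG,
    by simp [iUnion_const]⟩

theorem IsRealAffineVariety.isCountableUnionOfRelOpen {V : Set (EuclideanSpace ℝ (Fin n))}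
    (hV : IsRealAffineVariety V) : IsCountableUnionOfRelOpen V :=
  ⟨fun _ => V, fun _ => univ, fun _ => hV, fun _ => isOpen_univ, by simp [iUnion_const]⟩

theorem IsHalfSpace.isCountableUnionOfRelOpen {F : Set (EuclideanSpace ℝ (Fin n))}
    (hF : IsHalfSpace F) : IsCountableUnionOfRelOpen F := by
  obtain ⟨a, b, -, rfl | rfl⟩ := hF
  · have h : {x : EuclideanSpace ℝ (Fin n) | inner ℝ a x ≤ b} =
        {x | inner ℝ a x < b} ∪ {x | eval (fun i => x i) (∑ i, C (a i) * X i - C b) = 0} := by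
      ext x
      simp only [mem_ofPred_eq, mem_union, le_iff_lt_or_eq]
      refine or_congr Iff.rfl ?_
      simp [sub_eq_zero, PiLp.inner_apply, mul_comm]
    rw [h]
    exact (isOpen_lt (by fun_prop) continuous_const).isCountableUnionOfRelOpen.union
      (isRealAffineVariety_setOf_eval_eq_zero _).isCountableUnionOfRelOpen
  · exact (isOpen_lt (by fun_prop) continuous_const).isCountableUnionOfRelOpen

theorem IsConvexPolyhedron.isCountableUnionOfRelOpen {P : Set (EuclideanSpace ℝ (Fin n))}
    (hP : IsConvexPolyhedron P) : IsCountableUnionOfRelOpen P := by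
  obtain ⟨Fs, hfin, hFs, rfl⟩ := hP
  induction Fs, hfin using Set.Finite.induction_on with
  | empty => simpa using isOpen_univ.isCountableUnionOfRelOpen
  | insert _ _ ih =>
    rw [sInter_insert]
    exact (hFs _ (mem_insert _ _)).isCountableUnionOfRelOpen.inter
      (ih fun F hF => hFs F (mem_insert_of_mem _ hF))

theorem IsPolyhedron.isCountableUnionOfRelOpen {P : Set (EuclideanSpace ℝ (Fin n))}
    (hP : IsPolyhedron P) : IsCountableUnionOfRelOpen P := by
  obtain ⟨Cs, hfin, hCs, rfl⟩ := hP
  have := hfin.countable.to_subtype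
  rw [sUnion_eq_iUnion]
  exact .iUnion fun Q => (hCs Q Q.2).isCountableUnionOfRelOpen

theorem IsOpenOrClosedBall.isCountableUnionOfRelOpen {B : Set (EuclideanSpace ℝ (Fin n))}
    (hB : IsOpenOrClosedBall B) : IsCountableUnionOfRelOpen B := by
  obtain ⟨c, r, ⟨-, rfl⟩ | ⟨hr, rfl⟩⟩ := hB
  · exact Metric.isOpen_ball.isCountableUnionOfRelOpen
  · have h : Metric.sphere c r =
        {x | eval (fun i => x i) (∑ i, (X i - C (c i)) ^ 2 - C (r ^ 2)) = 0} := by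
      ext x
      rw [mem_sphere_iff_norm, ← sq_eq_sq₀ (norm_nonneg _) hr, EuclideanSpace.norm_sq_eq]
      simp [sub_eq_zero]
    rw [← Metric.ball_union_sphere, h]
    exact Metric.isOpen_ball.isCountableUnionOfRelOpen.union
      (isRealAffineVariety_setOf_eval_eq_zero _).isCountableUnionOfRelOpen

end Variety

theorem corollary7p4 (κ : Cardinal.{u}) (hκ : Cardinal.aleph0 < κ) (n : ℕ) :
    (∀ C : MultiCover.{u} (EuclideanSpace ℝ (Fin n)),
      C.IsFoldCover κ → (∀ H ∈ C.sets, IsCountableUnionOfRelOpen H) → C.SplitsInto κ) ∧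
    (∀ C : MultiCover.{u} (EuclideanSpace ℝ (Fin n)),
      C.IsFoldCover κ → (∀ H ∈ C.sets, IsOpenOrClosedPolyhedron H) → C.SplitsInto κ) ∧
    (∀ C : MultiCover.{u} (EuclideanSpace ℝ (Fin n)),
      C.IsFoldCover κ → (∀ H ∈ C.sets, IsOpenOrClosedBall H) → C.SplitsInto κ) := by
  refine ⟨fun C hC hH => hC.splitsInto hκ hH, fun C hC hH => hC.splitsInto hκ fun H h => ?_,
    fun C hC hH => hC.splitsInto hκ fun H h => ?_⟩
  · exact (hH H h).1.isCountableUnionOfRelOpen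
  · exact (hH H h).isCountableUnionOfRelOpen
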